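/- Let $\Psi\colon[0,\infty)\to[0,\infty)$ be an Orlicz function, i.e. a non-decreasing convex function with $\Psi(0)=0$ and $\Psi(x)\to\infty$ as $x\to\infty$; for $y>0$ let $\Psi^{-1}(y)$ be the unique $x\ge 0$ with $\Psi(x)=y$. Let $m$ be the normalized Lebesgue measure on the unit circle $\mathbb T$ and $\mathcal A$ the normalized area measure on the open unit disk $\mathbb D$. For measurable $g$ on $\mathbb T$, $g\in L^\Psi(m)$ means $\int_{\mathbb T}\Psi(|g|/C)\,dm<\infty$ for some $C>0$, and $\|g\|_\Psi=\inf\{C>0:\int_{\mathbb T}\Psi(|g|/C)\,dm\le 1\}$. Let $H^\Psi$ be the Hardy--Orlicz space of all $f\in H^1(\mathbb D)$ whose boundary values function $f^*$ belongs to $L^\Psi(m)$, with norm $\|f\|_{H^\Psi}=\|f^*\|_\Psi$. Let $L^{\Psi,\infty}(\mathbb D,\mathcal A)$ be the weak Orlicz space of all measurable $h$ on $\mathbb D$ for which there is a constant $c>0$ such that $\mathcal A(|h|>t)\le 1/\Psi(ct)$ for every $t>0$ (with $1/0=\infty$). Then the canonical injection $J_\Psi\colon f\mapsto f$ of $H^\Psi$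 into the Bergman--Orlicz space (the analytic functions in $L^\Psi(\mathbb D,\mathcal A)$) is order bounded into $L^{\Psi,\infty}(\mathbb D,\mathcal A)$: there is $y\ge0$ in $L^{\Psi,\infty}(\mathbb D,\mathcal A)$ such that $|f|\le y$ $\mathcal A$-almost everywhere for every $f$ with $\|f\|_{H^\Psi}\le 1$. More precisely, the pointwise supremum $S(z)=\sup_{\|f\|_{H^\Psi}\le 1}|f(z)|$ is finite for every $z\in\mathbb D$ and satisfies $$\frac14\,\Psi^{-1}\Big(\frac1{1-|z|}\Big)\le S(z)\le 4\,\Psi^{-1}\Big(\frac1{1-|z|}\Big)\qquad(z\in\mathbb D),$$ and $S\in L^{\Psi,\infty}(\mathbb D,\mathcal A)$. -/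

import Mathlib

open MeasureTheory Filter Topology Set

noncomputable section

namespace HardyOrlicz

/-- An Orlicz function: non-decreasing, convex, finite on `[0, ∞)`, with `Ψ 0 = 0` and
`Ψ x → ∞` as `x → ∞`. Only the values of `Ψ` on `[0, ∞)` matter. -/
structure IsOrliczFunction (Ψ : ℝ → ℝ) : Prop where
  monotoneOn : MonotoneOn Ψ (Ici 0)
  convexOn : ConvexOn ℝ (Ici 0) Ψ
  map_zero : Ψ 0 = 0
  tendsto_atTop : Tendsto Ψ atTop atTop

/-- The inverse `Ψ⁻¹` of an Orlicz function. For `y > 0` there is exactly one `x ≥ 0` with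
`Ψ x = y`, and this infimum is that `x`. -/
def orliczInv (Ψ : ℝ → ℝ) (y : ℝ) : ℝ := sInf {x : ℝ | 0 ≤ x ∧ y ≤ Ψ x}

section Spaces

variable {S : Type*} [MeasurableSpace S] {E : Type*} [NormedAddCommGroup E]

/-- `∫ Ψ(|f| / C) dμ`, as an element of `[0, ∞]`. -/
def modular (Ψ : ℝ → ℝ) (f : S → E) (μ : Measure S) (C : ℝ) : ENNReal :=
  ∫⁻ x, ENNReal.ofReal (Ψ (‖f x‖ / C)) ∂μ

/-- The Orlicz space `L^Ψ(μ)`. -/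
def MemOrlicz (Ψ : ℝ → ℝ) (f : S → E) (μ : Measure S) : Prop :=
  AEStronglyMeasurable f μ ∧ ∃ C : ℝ, 0 < C ∧ modular Ψ f μ C < ⊤

/-- The Luxemburg norm `‖f‖_Ψ`. -/
def luxemburgNorm (Ψ : ℝ → ℝ) (f : S → E) (μ : Measure S) : ℝ :=
  sInf {C : ℝ | 0 < C ∧ modular Ψ f μ C ≤ 1}

/-- The weak Orlicz space `L^{Ψ,∞}(μ)`: for some `c > 0`, `μ(|f| > t) ≤ 1 / Ψ(ct)` for all
`t > 0`, where `1 / 0 = ∞`. -/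
def MemWeakOrlicz (Ψ : ℝ → ℝ) (f : S → E) (μ : Measure S) : Prop :=
  AEStronglyMeasurable f μ ∧
    ∃ c : ℝ, 0 < c ∧ ∀ t : ℝ, 0 < t → μ {x | t < ‖f x‖} ≤ (ENNReal.ofReal (Ψ (c * t)))⁻¹

end Spaces

/-- The open unit disk. -/
abbrev disk : Set ℂ := Metric.ball 0 1

/-- The normalized area measure on the unit disk, `dx dy / π`. -/
def diskMeasure : Measure ℂ := ENNReal.ofReal (Real.pi)⁻¹ • volume.restrict disk

/-- The normalized Lebesgue measure on the unit circle, the image of `dt / 2π` on `(0, 2π]`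
under `t ↦ e^{it}`, as a measure on `ℂ` carried by the circle. -/
def circleMeasure : Measure ℂ :=
  Measure.map (fun t : ℝ => circleMap 0 1 t)
    (ENNReal.ofReal (2 * Real.pi)⁻¹ • (volume : Measure ℝ).restrict (Ioc 0 (2 * Real.pi)))

/-- The Hardy space `H¹` of the disk. A function on the disk is represented by a function on `ℂ`
whose values outside the disk are irrelevant. -/
def MemHardyOne (f : ℂ → ℂ) : Prop :=
  DifferentiableOn ℂ f disk ∧
    ∃ M : ℝ, ∀ r : ℝ, 0 ≤ r → r < 1 →
      ∫ ζ, ‖f ((r : ℂ) * ζ)‖ ∂circleMeasure ≤ M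

/-- `g` is the boundary values function `f*` of `f`: the radial limit of `f` almost everywhere.
(It is unique up to a null set, and every `f ∈ H¹` has one.) -/
def HasBoundaryValues (f : ℂ → ℂ) (g : ℂ → ℂ) : Prop :=
  ∀ᵐ ζ ∂circleMeasure,
    Tendsto (fun r : ℝ => f ((r : ℂ) * ζ)) (𝓝[<] 1) (𝓝 (g ζ))

/-- `f` belongs to the Hardy-Orlicz space `H^Ψ = {f ∈ H¹ : f* ∈ L^Ψ}`, and its norm
`‖f‖_{H^Ψ} = ‖f*‖_Ψ` is `N`. -/
def HasHardyOrliczNorm (Ψ : ℝ → ℝ) (f : ℂ → ℂ) (N : ℝ) : Prop :=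
  MemHardyOne f ∧ ∃ g : ℂ → ℂ, HasBoundaryValues f g ∧
    MemOrlicz Ψ g circleMeasure ∧ luxemburgNorm Ψ g circleMeasure = N

/-- The closed unit ball of `H^Ψ`. -/
def unitBall (Ψ : ℝ → ℝ) : Set (ℂ → ℂ) := {f | ∃ N : ℝ, HasHardyOrliczNorm Ψ f N ∧ N ≤ 1}

/-- The set of the `|f(z)|`, where `f` runs over the unit ball of `H^Ψ`. -/
def evalSet (Ψ : ℝ → ℝ) (z : ℂ) : Set ℝ := (fun f : ℂ → ℂ => ‖f z‖) '' unitBall Ψ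

/-- The pointwise supremum of `|f|` over the unit ball of `H^Ψ`. -/
def ballSup (Ψ : ℝ → ℝ) (z : ℂ) : ℝ := sSup (evalSet Ψ z)

/-- The canonical injection `J_Ψ f = f` on `H^Ψ` is order bounded into `L^{Ψ,∞}(𝔻, 𝒜)`: some
`y ≥ 0` in that space satisfies `|J_Ψ f| ≤ y` almost everywhere for all `f` in the unit ball. -/
def InjectionOrderBounded (Ψ : ℝ → ℝ) : Prop :=
  ∃ y : ℂ → ℝ, MemWeakOrlicz Ψ y diskMeasure ∧ (∀ z, 0 ≤ y z) ∧
    ∀ f ∈ unitBall Ψ, ∀ᵐ z ∂diskMeasure, ‖f z‖ ≤ y z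

end HardyOrlicz

end

/-! Write L(z) = Ψ⁻¹(1/(1-|z|)) and let P_z be the Poisson measure at z, a probability measure with
density at most 2/(1-|z|).

Upper bound: |f(z)| ≤ ∫ |f*| dP_z for f in H¹ (`norm_le_integral_norm_boundary`). Jensen's
inequality then bounds Ψ(|f(z)|/C) by ∫ Ψ(|f*|/C) dP_z ≤ 2/(1-|z|) for every C > 1. By concavity of
the inverse, |f(z)| ≤ 2 L(z), which is better than the stated 4 L(z). The H¹ inequality does not use
L¹ convergence of the dilates f_r. The functions √|f_r| are bounded in L², hence uniformly
integrable, so the subharmonic inequality for √|f_r| passes to the radial limit; Jensen for the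
square removes the root.

Lower bound: L(a) ((1-|a|)/(1 - conj a · w))² lies in the unit ball, since on the circle the squared
factor has modulus at most 1 and proportional to the Poisson kernel. At w = a its modulus is at
least L(a)/4.

Weak type: S(z) > t forces 1-|z| < 1/Ψ(t/4), a thin annulus of area at most 2/Ψ(t/4) ≤ 1/Ψ(t/8).
Thus S itself is the order bound. -/

noncomputable section

namespace HardyOrlicz

/-! ### Circle measure and Poisson measures -/

section PoissonMeasure

lemma measurable_circleMap_one : Measurable (fun t : ℝ => circleMap 0 1 t) :=
  (continuous_circleMap 0 1).measurable

instance isProbabilityMeasure_circleMeasure : IsProbabilityMeasure circleMeasure := by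
  refine ⟨?_⟩
  rw [circleMeasure, Measure.map_apply measurable_circleMap_one MeasurableSet.univ]
  have : (0 : ℝ) < 2 * Real.pi := by positivity
  simp only [preimage_univ, Measure.smul_apply, MeasurableSet.univ, Measure.restrict_apply,
    univ_inter, Real.volume_Ioc, sub_zero, smul_eq_mul]
  rw [← ENNReal.ofReal_mul (by positivity), inv_mul_cancel₀ this.ne', ENNReal.ofReal_one]

lemma ae_mem_sphere : ∀ᵐ ζ ∂circleMeasure, ζ ∈ Metric.sphere (0 : ℂ) 1 := by
  refine (ae_map_iff (p := (· ∈ Metric.sphere (0 : ℂ) 1)) measurable_circleMap_one.aemeasurable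
    Metric.isClosed_sphere.measurableSet).2 ?_
  exact Eventually.of_forall fun t => circleMap_mem_sphere 0 zero_le_one t

lemma ae_norm_eq_one : ∀ᵐ ζ ∂circleMeasure, ‖ζ‖ = 1 := by
  filter_upwards [ae_mem_sphere] with ζ h using by simpa using h

lemma integral_circleMeasure {E : Type*} [NormedAddCommGroup E] [NormedSpace ℝ E] {f : ℂ → E}
    (hf : AEStronglyMeasurable f circleMeasure) :
    ∫ ζ, f ζ ∂circleMeasure = Real.circleAverage f 0 1 := by
  have h : (0 : ℝ) ≤ (2 * Real.pi)⁻¹ := by positivity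
  rw [Real.circleAverage_def, intervalIntegral.integral_of_le (by positivity)]
  unfold circleMeasure at hf ⊢
  rw [integral_map measurable_circleMap_one.aemeasurable hf, integral_smul_measure,
    ENNReal.toReal_ofReal h]

lemma aestronglyMeasurable_circleMeasure {E : Type*} [NormedAddCommGroup E] {f : ℂ → E}
    (hf : ContinuousOn f (Metric.sphere 0 1)) : AEStronglyMeasurable f circleMeasure := by
  have h := hf.aestronglyMeasurable_of_isCompact (μ := circleMeasure)
    (isCompact_sphere (0 : ℂ) 1) Metric.isClosed_sphere.measurableSet
  rwa [Measure.restrict_eq_self_of_ae_mem ae_mem_sphere] at h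

/-- The harmonic measure of the disk at `z`: the Poisson kernel times the normalized Lebesgue
measure on the circle. -/
def poissonMeasure (z : ℂ) : Measure ℂ :=
  circleMeasure.withDensity fun ζ => ENNReal.ofReal (poissonKernel 0 z ζ)

lemma measurable_poissonKernel (z : ℂ) : Measurable (poissonKernel 0 z) := by
  have : poissonKernel 0 z = fun ζ => (‖ζ - 0‖ ^ 2 - ‖z - 0‖ ^ 2) / ‖(ζ - 0) - (z - 0)‖ ^ 2 := rfl
  rw [this]; fun_prop

variable {z : ℂ}

lemma poissonMeasure_absolutelyContinuous : poissonMeasure z ≪ circleMeasure :=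
  withDensity_absolutelyContinuous _ _

lemma ae_poissonMeasure_mem_sphere : ∀ᵐ ζ ∂poissonMeasure z, ζ ∈ Metric.sphere (0 : ℂ) 1 :=
  poissonMeasure_absolutelyContinuous.ae_le ae_mem_sphere

lemma poissonKernel_nonneg (hz : z ∈ disk) {ζ : ℂ} (hζ : ζ ∈ Metric.sphere (0 : ℂ) 1) :
    0 ≤ poissonKernel 0 z ζ := by
  have h1 : ‖z‖ < 1 := by simpa using hz
  have h2 : ‖ζ‖ = 1 := by simpa using hζ
  rw [poissonKernel_def]
  simp only [sub_zero, h2]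
  apply div_nonneg _ (by positivity)
  nlinarith [norm_nonneg z]

lemma poissonKernel_le (hz : z ∈ disk) {ζ : ℂ} (hζ : ζ ∈ Metric.sphere (0 : ℂ) 1) :
    poissonKernel 0 z ζ ≤ 2 / (1 - ‖z‖) := by
  have h1 : ‖z‖ < 1 := by simpa using hz
  have h := re_herglotzRieszKernel_le hζ hz
  rw [poissonKernel_eq_re_herglotzRieszKernel]
  refine h.trans ?_
  rw [sub_zero]
  have : 0 < 1 - ‖z‖ := by linarith
  gcongr
  linarith

lemma continuousOn_poissonKernel (hz : z ∈ disk) :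
    ContinuousOn (poissonKernel 0 z) (Metric.sphere 0 1) := by
  have h := continuousOn_herglotzRieszKernel_sphere (R := 1) hz
  rw [abs_one] at h
  rw [poissonKernel_eq_re_herglotzRieszKernel]
  exact Complex.continuous_re.comp_continuousOn h

lemma integral_poissonMeasure (hz : z ∈ disk) {E : Type*} [NormedAddCommGroup E] [NormedSpace ℝ E]
    (f : ℂ → E) :
    ∫ ζ, f ζ ∂poissonMeasure z = ∫ ζ, poissonKernel 0 z ζ • f ζ ∂circleMeasure := by
  rw [poissonMeasure, integral_withDensity_eq_integral_toReal_smul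
    (measurable_poissonKernel z).ennreal_ofReal (by simp)]
  refine integral_congr_ae ?_
  filter_upwards [ae_mem_sphere] with ζ hζ
  rw [ENNReal.toReal_ofReal (poissonKernel_nonneg hz hζ)]

lemma poissonMeasure_le (hz : z ∈ disk) :
    poissonMeasure z ≤ ENNReal.ofReal (2 / (1 - ‖z‖)) • circleMeasure := by
  rw [poissonMeasure, ← withDensity_const]
  refine withDensity_mono ?_
  filter_upwards [ae_mem_sphere] with ζ hζ
  exact ENNReal.ofReal_le_ofReal (poissonKernel_le hz hζ)

/-- The Poisson integral formula. -/
lemma integral_poissonMeasure_of_diffContOnCl (hz : z ∈ disk) {E : Type*} [NormedAddCommGroup E]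
    [NormedSpace ℂ E] [CompleteSpace E] {f : ℂ → E} (hf : DiffContOnCl ℂ f disk) :
    ∫ ζ, f ζ ∂poissonMeasure z = f z := by
  have hfc : ContinuousOn f (Metric.sphere 0 1) :=
    hf.continuousOn_ball.mono Metric.sphere_subset_closedBall
  rw [integral_poissonMeasure hz, ← hf.circleAverage_poissonKernel_smul hz]
  exact integral_circleMeasure
    (aestronglyMeasurable_circleMeasure ((continuousOn_poissonKernel hz).smul hfc))

lemma integrable_circleMeasure {E : Type*} [NormedAddCommGroup E] {f : ℂ → E}
    (hf : ContinuousOn f (Metric.sphere 0 1)) : Integrable f circleMeasure := by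
  obtain ⟨C, hC⟩ := (isCompact_sphere (0 : ℂ) 1).exists_bound_of_continuousOn hf
  refine Integrable.of_bound (aestronglyMeasurable_circleMeasure hf) C ?_
  filter_upwards [ae_mem_sphere] with ζ hζ using hC ζ hζ

/-- The total mass is the Poisson integral of the holomorphic function 1. -/
lemma isProbabilityMeasure_poissonMeasure (hz : z ∈ disk) :
    IsProbabilityMeasure (poissonMeasure z) := by
  have h := integral_poissonMeasure_of_diffContOnCl hz (f := fun _ => (1 : ℂ))
    diffContOnCl_const
  refine ⟨?_⟩
  simp only [integral_const, Complex.real_smul, mul_one] at h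
  have h' : (poissonMeasure z).real univ = 1 := by exact_mod_cast h
  rw [measureReal_def, ENNReal.toReal_eq_one_iff] at h'
  exact h'

lemma integrable_poissonMeasure (hz : z ∈ disk) {E : Type*} [NormedAddCommGroup E] {f : ℂ → E}
    (hf : Integrable f circleMeasure) : Integrable f (poissonMeasure z) :=
  (hf.smul_measure ENNReal.ofReal_ne_top).mono_measure (poissonMeasure_le hz)

lemma integral_poissonMeasure_le (hz : z ∈ disk) {f : ℂ → ℝ} (hf : Integrable f circleMeasure)
    (h0 : ∀ ζ, 0 ≤ f ζ) :
    ∫ ζ, f ζ ∂poissonMeasure z ≤ 2 / (1 - ‖z‖) * ∫ ζ, f ζ ∂circleMeasure := by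
  have h1 : ‖z‖ < 1 := by simpa using hz
  have h2 : 0 ≤ 2 / (1 - ‖z‖) := div_nonneg zero_le_two (by linarith)
  have h := integral_mono_measure (poissonMeasure_le hz) (Eventually.of_forall h0)
    (hf.smul_measure ENNReal.ofReal_ne_top)
  rwa [integral_smul_measure, ENNReal.toReal_ofReal h2, smul_eq_mul] at h

end PoissonMeasure

/-! ### Subharmonicity of the square root of the modulus -/

section Subharmonic

open Polynomial in
/-- Real parts of polynomials are dense in the real continuous functions on the unit circle. -/
lemma exists_polynomial_re_near {g : ℂ → ℝ} (hg : ContinuousOn g (Metric.sphere 0 1)) {ε : ℝ}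
    (hε : 0 < ε) :
    ∃ Q : ℂ[X], ∀ ζ ∈ Metric.sphere (0 : ℂ) 1, |(Q.eval ζ).re - g ζ| ≤ ε := by
  have : Fact (0 < 2 * Real.pi) := ⟨by positivity⟩
  let e : AddCircle (2 * Real.pi) → ℂ := fun t => (AddCircle.toCircle t : ℂ)
  have he : Continuous e := continuous_subtype_val.comp AddCircle.continuous_toCircle
  have hmem : ∀ t, e t ∈ Metric.sphere (0 : ℂ) 1 := fun t => by
    simpa [e] using Circle.norm_coe (AddCircle.toCircle t)
  let G : C(AddCircle (2 * Real.pi), ℂ) :=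
    ⟨fun t => (g (e t) : ℂ), Complex.continuous_ofReal.comp (hg.comp_continuous he hmem)⟩
  have hG : G ∈ (Submodule.span ℂ (range (fourier (T := 2 * Real.pi)))).topologicalClosure := by
    rw [span_fourier_closure_eq_top]; trivial
  obtain ⟨p, hp, hpG⟩ := Metric.mem_closure_iff.1
    (show G ∈ closure (Submodule.span ℂ (range (fourier (T := 2 * Real.pi))) :
      Set C(AddCircle (2 * Real.pi), ℂ)) from hG) ε hε
  -- On the circle the negative frequencies are conjugates of positive powers. Conjugation leaves
  -- real parts unchanged, so Q₁ + Q₂ will do.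
  have key : ∃ Q₁ Q₂ : ℂ[X], ∀ t, p t = Q₁.eval (e t) + starRingEnd ℂ (Q₂.eval (e t)) := by
    refine Submodule.span_induction (p := fun p _ => ∃ Q₁ Q₂ : ℂ[X], ∀ t,
      p t = Q₁.eval (e t) + starRingEnd ℂ (Q₂.eval (e t))) ?_ ?_ ?_ ?_ hp
    · rintro _ ⟨n, rfl⟩
      obtain ⟨k, rfl | rfl⟩ := n.eq_nat_or_neg
      · refine ⟨X ^ k, 0, fun t => ?_⟩
        simp [fourier_apply, e, AddCircle.toCircle_nsmul]
      · refine ⟨0, X ^ k, fun t => ?_⟩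
        rw [fourier_neg]
        simp [fourier_apply, e, AddCircle.toCircle_nsmul]
    · exact ⟨0, 0, fun t => by simp⟩
    · rintro x y - - ⟨a, b, h⟩ ⟨c, d, h'⟩
      refine ⟨a + c, b + d, fun t => ?_⟩
      simp only [ContinuousMap.add_apply, h, h', eval_add, map_add]
      ring
    · rintro c x - ⟨a, b, h⟩
      refine ⟨C c * a, C (starRingEnd ℂ c) * b, fun t => ?_⟩
      simp only [ContinuousMap.smul_apply, h, eval_mul, eval_C, map_mul, smul_eq_mul,
        Complex.conj_conj]
      ring
  obtain ⟨Q₁, Q₂, hQ⟩ := key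
  refine ⟨Q₁ + Q₂, fun ζ hζ => ?_⟩
  obtain ⟨t, ht⟩ := (AddCircle.homeomorphCircle (T := 2 * Real.pi) Real.two_pi_pos.ne').surjective ⟨ζ, hζ⟩
  have hte : e t = ζ := by
    have := congrArg (Subtype.val) ht
    rwa [AddCircle.homeomorphCircle_apply] at this
  have hd : dist (G t) (p t) < ε := (ContinuousMap.dist_apply_le_dist t).trans_lt hpG
  have h1 : (p t - G t).re = ((Q₁ + Q₂).eval ζ).re - g ζ := by
    simp [G, hQ, hte]
  rw [← h1]
  refine (Complex.abs_re_le_norm _).trans ?_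
  rw [dist_comm, dist_eq_norm] at hd
  exact hd.le

/-- Subharmonicity of `|F| ^ (1/2)`, for `F` holomorphic in the disk and continuous up to the
boundary. -/
lemma sqrt_norm_le_integral_poissonMeasure {F : ℂ → ℂ} (hF : DiffContOnCl ℂ F disk) {z : ℂ}
    (hz : z ∈ disk) :
    √‖F z‖ ≤ ∫ ζ, √‖F ζ‖ ∂poissonMeasure z := by
  have := isProbabilityMeasure_poissonMeasure hz
  have hFc : ContinuousOn F (Metric.sphere 0 1) :=
    hF.continuousOn_ball.mono Metric.sphere_subset_closedBall
  set u : ℂ → ℝ := fun ζ => √‖F ζ‖ with hu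
  have huc : ContinuousOn u (Metric.sphere 0 1) := hFc.norm.sqrt
  have hu0 : ∀ ζ, 0 ≤ u ζ := fun ζ => Real.sqrt_nonneg _
  have main : ∀ ε : ℝ, 0 < ε →
      u z ≤ Real.exp (2 * ε) * ((∫ ζ, u ζ ∂poissonMeasure z) + ε) := by
    intro ε hε
    have hpos : ∀ ζ, 0 < u ζ + ε := fun ζ => by linarith [hu0 ζ]
    -- Adding ε keeps the logarithm continuous at zeros of F. With Re Q close to g, the product F
    -- e^{-2Q} is almost bounded by 1 on the circle, and the maximum principle applies without
    -- factoring out zeros.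
    set g : ℂ → ℝ := fun ζ => Real.log (u ζ + ε) with hgdef
    have hgc : ContinuousOn g (Metric.sphere 0 1) :=
      (huc.add continuousOn_const).log fun ζ _ => (hpos ζ).ne'
    obtain ⟨Q, hQ⟩ := exists_polynomial_re_near hgc hε
    have hQd : Differentiable ℂ fun w => Q.eval w := Q.differentiable
    have hg_int : Integrable g (poissonMeasure z) :=
      integrable_poissonMeasure hz (integrable_circleMeasure hgc)
    have hu_int : Integrable u (poissonMeasure z) :=
      integrable_poissonMeasure hz (integrable_circleMeasure huc)
    have hQ_int : Integrable (fun w => Q.eval w) (poissonMeasure z) :=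
      integrable_poissonMeasure hz (integrable_circleMeasure hQd.continuous.continuousOn)
    have hmax : ‖F z * Complex.exp (-2 * Q.eval z)‖ ≤ Real.exp (2 * ε) := by
      refine Complex.norm_le_of_forall_mem_frontier_norm_le (U := disk)
        (f := fun w => F w * Complex.exp (-2 * Q.eval w)) Metric.isBounded_ball ?_ ?_
        (subset_closure hz)
      · exact hF.smul (Differentiable.diffContOnCl (by fun_prop))
      · intro ζ hζ
        rw [frontier_ball (0 : ℂ) one_ne_zero] at hζ
        have h1 := (abs_le.1 (hQ ζ hζ)).1
        have h2 : ‖F ζ‖ ≤ Real.exp (2 * g ζ) := by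
          rw [two_mul, Real.exp_add, hgdef, Real.exp_log (hpos ζ),
            ← Real.mul_self_sqrt (norm_nonneg (F ζ))]
          exact mul_le_mul (by linarith) (by linarith) (hu0 ζ) (hpos ζ).le
        rw [norm_mul, Complex.norm_exp]
        have h3 : (-2 * Q.eval ζ).re = -2 * (Q.eval ζ).re := by simp
        rw [h3]
        calc ‖F ζ‖ * Real.exp (-2 * (Q.eval ζ).re)
            ≤ Real.exp (2 * g ζ) * Real.exp (-2 * (Q.eval ζ).re) := by gcongr
          _ = Real.exp (2 * g ζ + -2 * (Q.eval ζ).re) := (Real.exp_add _ _).symm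
          _ ≤ Real.exp (2 * ε) := Real.exp_le_exp.2 (by linarith)
    have hQz : (Q.eval z).re ≤ (∫ ζ, g ζ ∂poissonMeasure z) + ε := by
      have h1 : (Q.eval z).re = ∫ ζ, (Q.eval ζ).re ∂poissonMeasure z := by
        have := integral_re hQ_int
        rw [integral_poissonMeasure_of_diffContOnCl hz hQd.diffContOnCl] at this
        exact this.symm
      have h2 : (∫ ζ, g ζ ∂poissonMeasure z) + ε = ∫ ζ, (g ζ + ε) ∂poissonMeasure z := by
        rw [integral_add hg_int (integrable_const _)]; simp
      rw [h1, h2]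
      refine integral_mono_ae hQ_int.re (hg_int.add (integrable_const _)) ?_
      filter_upwards [ae_poissonMeasure_mem_sphere] with ζ hζ
      have := (abs_le.1 (hQ ζ hζ)).2
      show (Q.eval ζ).re ≤ g ζ + ε
      linarith
    have hjensen : Real.exp (∫ ζ, g ζ ∂poissonMeasure z) ≤ (∫ ζ, u ζ ∂poissonMeasure z) + ε := by
      have hexp : (Real.exp ∘ g) = fun ζ => u ζ + ε :=
        funext fun ζ => Real.exp_log (hpos ζ)
      have h1 : Integrable (Real.exp ∘ g) (poissonMeasure z) := by
        rw [hexp]; exact hu_int.add (integrable_const _)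
      have h2 := convexOn_exp.map_integral_le Real.continuous_exp.continuousOn isClosed_univ
        (by simp) hg_int h1
      have h3 : ∫ ζ, Real.exp (g ζ) ∂poissonMeasure z = ∫ ζ, (u ζ + ε) ∂poissonMeasure z :=
        integral_congr_ae (Eventually.of_forall fun ζ => congrFun hexp ζ)
      rw [h3, integral_add hu_int (integrable_const _)] at h2
      simpa using h2
    have hFz : ‖F z‖ ≤ Real.exp (2 * ε) * Real.exp (2 * (Q.eval z).re) := by
      rw [norm_mul, Complex.norm_exp] at hmax
      have h3 : (-2 * Q.eval z).re = -(2 * (Q.eval z).re) := by simp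
      rw [h3, Real.exp_neg, ← div_eq_mul_inv, div_le_iff₀ (Real.exp_pos _)] at hmax
      exact hmax
    have huz : u z ≤ Real.exp (ε + (Q.eval z).re) := by
      refine Real.sqrt_le_iff.2 ⟨(Real.exp_pos _).le, hFz.trans_eq ?_⟩
      rw [← Real.exp_add, ← Real.exp_nat_mul]
      congr 1; push_cast; ring
    calc u z ≤ Real.exp (ε + (Q.eval z).re) := huz
      _ ≤ Real.exp (2 * ε + ∫ ζ, g ζ ∂poissonMeasure z) := Real.exp_le_exp.2 (by linarith)
      _ = Real.exp (2 * ε) * Real.exp (∫ ζ, g ζ ∂poissonMeasure z) := Real.exp_add _ _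
      _ ≤ _ := by gcongr
  have hlim : Tendsto (fun ε : ℝ => Real.exp (2 * ε) * ((∫ ζ, u ζ ∂poissonMeasure z) + ε))
      (𝓝[>] 0) (𝓝 (∫ ζ, u ζ ∂poissonMeasure z)) := by
    have hc : Continuous fun ε : ℝ => Real.exp (2 * ε) * ((∫ ζ, u ζ ∂poissonMeasure z) + ε) := by
      fun_prop
    have := hc.tendsto 0
    simp only [mul_zero, Real.exp_zero, add_zero, one_mul] at this
    exact this.mono_left nhdsWithin_le_nhds
  refine ge_of_tendsto hlim ?_
  filter_upwards [self_mem_nhdsWithin] with ε hε using main ε hε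

end Subharmonic

/-! ### Poisson domination in H¹ -/

section HardyOne

lemma integrable_sqrt_norm {S E : Type*} [MeasurableSpace S] [NormedAddCommGroup E]
    {μ : Measure S} [IsFiniteMeasure μ] {g : S → E} (hg : Integrable g μ) :
    Integrable (fun x => √‖g x‖) μ := by
  refine ((integrable_const (1 : ℝ)).add hg.norm).mono'
    (Real.continuous_sqrt.comp_aestronglyMeasurable hg.1.norm) (Eventually.of_forall fun x => ?_)
  rw [Real.norm_of_nonneg (Real.sqrt_nonneg _), Real.sqrt_le_iff]
  have := norm_nonneg (g x)
  simp only [Pi.add_apply]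
  constructor <;> nlinarith

/-- Quantitative uniform integrability: an L¹ bound on t makes the part of √t above C uniformly
small as C grows. -/
lemma sqrt_le_min_add_div {t C : ℝ} (ht : 0 ≤ t) (hC : 0 < C) : √t ≤ min (√t) C + t / C := by
  rcases le_total (√t) C with h | h
  · rw [min_eq_left h]
    have : 0 ≤ t / C := by positivity
    linarith
  · rw [min_eq_right h]
    have : √t ≤ t / C := by
      rw [le_div_iff₀ hC]
      nlinarith [Real.mul_self_sqrt ht, Real.sqrt_nonneg t]
    linarith

/-- A function of the Hardy space `H¹` is dominated by the Poisson integral of the modulus of its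
boundary values. -/
lemma norm_le_integral_norm_boundary {f g : ℂ → ℂ} (hf : MemHardyOne f)
    (hfg : HasBoundaryValues f g) (hg : Integrable g circleMeasure) {z : ℂ} (hz : z ∈ disk) :
    ‖f z‖ ≤ ∫ ζ, ‖g ζ‖ ∂poissonMeasure z := by
  have := isProbabilityMeasure_poissonMeasure hz
  obtain ⟨hfd, M, hM⟩ := hf
  have hz1 : ‖z‖ < 1 := by simpa using hz
  have hK : 0 ≤ 2 / (1 - ‖z‖) := div_nonneg zero_le_two (by linarith)
  set K := 2 / (1 - ‖z‖) with hKdef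
  have hgμ : Integrable g (poissonMeasure z) := integrable_poissonMeasure hz hg
  have hsg : Integrable (fun ζ => √‖g ζ‖) (poissonMeasure z) := integrable_sqrt_norm hgμ
  set R : ℕ → ℝ := fun n => 1 - 1 / ((n : ℝ) + 1) with hRdef
  have hR0 : ∀ n, 0 ≤ R n := fun n => by
    have : 1 / ((n : ℝ) + 1) ≤ 1 := by
      rw [div_le_one (by positivity)]; linarith [Nat.cast_nonneg (α := ℝ) n]
    simp only [hRdef]; linarith
  have hR1 : ∀ n, R n < 1 := fun n => by
    have : 0 < 1 / ((n : ℝ) + 1) := by positivity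
    simp only [hRdef]; linarith
  have hRlim : Tendsto R atTop (𝓝 1) := by
    simpa [hRdef] using (tendsto_one_div_add_atTop_nhds_zero_nat (𝕜 := ℝ)).const_sub 1
  have hRlim' : Tendsto R atTop (𝓝[<] 1) :=
    tendsto_nhdsWithin_iff.2 ⟨hRlim, Eventually.of_forall hR1⟩
  have hmaps : ∀ n, MapsTo (fun w : ℂ => (R n : ℂ) * w) (Metric.closedBall 0 1) disk := by
    intro n w hw
    have hw1 : ‖w‖ ≤ 1 := by simpa using hw
    rw [mem_ball_zero_iff, norm_mul, Complex.norm_real, Real.norm_of_nonneg (hR0 n)]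
    nlinarith [hR0 n, hR1 n, norm_nonneg w]
  have hFd : ∀ n, DifferentiableOn ℂ (fun w => f ((R n : ℂ) * w)) (Metric.closedBall 0 1) :=
    fun n => hfd.comp (by fun_prop) (hmaps n)
  have hF : ∀ n, DiffContOnCl ℂ (fun w => f ((R n : ℂ) * w)) disk := fun n => by
    refine DifferentiableOn.diffContOnCl ?_
    rw [closure_ball _ one_ne_zero]
    exact hFd n
  have hFi : ∀ n, Integrable (fun ζ => f ((R n : ℂ) * ζ)) circleMeasure := fun n =>
    integrable_circleMeasure ((hFd n).continuousOn.mono Metric.sphere_subset_closedBall)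
  have hFiμ := fun n => integrable_poissonMeasure hz (hFi n)
  have hfz : Tendsto (fun n => √‖f ((R n : ℂ) * z)‖) atTop (𝓝 √‖f z‖) := by
    have h1 : Tendsto (fun n => (R n : ℂ) * z) atTop (𝓝 z) := by
      simpa using ((Complex.continuous_ofReal.tendsto 1).comp hRlim).mul_const z
    have h2 : ContinuousAt f z := hfd.continuousOn.continuousAt (Metric.isOpen_ball.mem_nhds hz)
    exact (h2.tendsto.comp h1).norm.sqrt
  have hbd : ∀ᵐ ζ ∂poissonMeasure z,
      Tendsto (fun n => f ((R n : ℂ) * ζ)) atTop (𝓝 (g ζ)) := by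
    filter_upwards [poissonMeasure_absolutelyContinuous.ae_le hfg] with ζ hζ using hζ.comp hRlim'
  -- Truncation at C permits dominated convergence along the dilates. The remainder is controlled by
  -- the H¹ bound M and the kernel bound K, uniformly in n.
  have key : ∀ C : ℝ, 0 < C → √‖f z‖ ≤ (∫ ζ, √‖g ζ‖ ∂poissonMeasure z) + K * M / C := by
    intro C hC
    have hmeas : ∀ n, AEStronglyMeasurable (fun ζ => min √‖f ((R n : ℂ) * ζ)‖ C)
        (poissonMeasure z) := fun n =>
      (integrable_sqrt_norm (hFiμ n)).1.inf aestronglyMeasurable_const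
    have hminb : ∀ t : ℝ, ‖min (√t) C‖ ≤ C := fun t => by
      rw [Real.norm_of_nonneg (le_min (Real.sqrt_nonneg _) hC.le)]; exact min_le_right _ _
    have hn : ∀ n, √‖f ((R n : ℂ) * z)‖ ≤
        (∫ ζ, min √‖f ((R n : ℂ) * ζ)‖ C ∂poissonMeasure z) + K * M / C := by
      intro n
      have hmin : Integrable (fun ζ => min √‖f ((R n : ℂ) * ζ)‖ C) (poissonMeasure z) :=
        Integrable.of_bound (hmeas n) C (Eventually.of_forall fun ζ => hminb _)
      have hdiv : Integrable (fun ζ => ‖f ((R n : ℂ) * ζ)‖ / C) (poissonMeasure z) :=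
        (hFiμ n).norm.div_const C
      calc √‖f ((R n : ℂ) * z)‖ ≤ ∫ ζ, √‖f ((R n : ℂ) * ζ)‖ ∂poissonMeasure z :=
            sqrt_norm_le_integral_poissonMeasure (hF n) hz
        _ ≤ ∫ ζ, (min √‖f ((R n : ℂ) * ζ)‖ C + ‖f ((R n : ℂ) * ζ)‖ / C) ∂poissonMeasure z :=
            integral_mono (integrable_sqrt_norm (hFiμ n)) (hmin.add hdiv)
              fun ζ => sqrt_le_min_add_div (norm_nonneg _) hC
        _ = (∫ ζ, min √‖f ((R n : ℂ) * ζ)‖ C ∂poissonMeasure z) +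
              (∫ ζ, ‖f ((R n : ℂ) * ζ)‖ ∂poissonMeasure z) / C := by
            rw [integral_add hmin hdiv, integral_div]
        _ ≤ _ := by
            have h1 := integral_poissonMeasure_le hz (hFi n).norm fun ζ => norm_nonneg _
            have h2 := mul_le_mul_of_nonneg_left (hM (R n) (hR0 n) (hR1 n)) hK
            gcongr
            exact h1.trans h2
    have hlim : Tendsto (fun n => ∫ ζ, min √‖f ((R n : ℂ) * ζ)‖ C ∂poissonMeasure z) atTop
        (𝓝 (∫ ζ, min √‖g ζ‖ C ∂poissonMeasure z)) := by
      refine tendsto_integral_of_dominated_convergence (fun _ => C) hmeas (integrable_const C)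
        (fun n => Eventually.of_forall fun ζ => hminb _) ?_
      filter_upwards [hbd] with ζ hζ
      exact hζ.norm.sqrt.min tendsto_const_nhds
    have h1 := le_of_tendsto_of_tendsto' hfz (hlim.add_const (K * M / C)) hn
    refine h1.trans (add_le_add_left (integral_mono ?_ hsg fun ζ => min_le_left _ _) _)
    exact Integrable.of_bound (hsg.1.inf aestronglyMeasurable_const) C
      (Eventually.of_forall fun ζ => hminb _)
  have hsqrt : √‖f z‖ ≤ ∫ ζ, √‖g ζ‖ ∂poissonMeasure z := by
    have hlim : Tendsto (fun C : ℝ => (∫ ζ, √‖g ζ‖ ∂poissonMeasure z) + K * M / C) atTop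
        (𝓝 (∫ ζ, √‖g ζ‖ ∂poissonMeasure z)) := by
      simpa using (tendsto_const_nhds (x := K * M)).div_atTop tendsto_id |>.const_add
        (∫ ζ, √‖g ζ‖ ∂poissonMeasure z)
    refine ge_of_tendsto hlim ?_
    filter_upwards [eventually_gt_atTop 0] with C hC using key C hC
  have hsq : ∀ ζ, √‖g ζ‖ ^ 2 = ‖g ζ‖ := fun ζ => Real.sq_sqrt (norm_nonneg _)
  -- Jensen for the square turns the bound on √|f(z)| into the bound on |f(z)|.
  have hjensen := (even_two.convexOn_pow (𝕜 := ℝ)).map_integral_le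
    (continuous_pow 2).continuousOn isClosed_univ (by simp) hsg
    (by simpa only [Function.comp_def, hsq] using hgμ.norm)
  simp only [hsq] at hjensen
  calc ‖f z‖ = √‖f z‖ ^ 2 := (Real.sq_sqrt (norm_nonneg _)).symm
    _ ≤ (∫ ζ, √‖g ζ‖ ∂poissonMeasure z) ^ 2 := by gcongr
    _ ≤ _ := hjensen

end HardyOne

/-! ### Orlicz functions and the Luxemburg norm -/

section Orlicz

variable {Ψ : ℝ → ℝ} (hΨ : IsOrliczFunction Ψ)
include hΨ

lemma IsOrliczFunction.nonneg {x : ℝ} (hx : 0 ≤ x) : 0 ≤ Ψ x := by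
  rw [← hΨ.map_zero]; exact hΨ.monotoneOn self_mem_Ici hx hx

lemma IsOrliczFunction.map_mul_le {a x : ℝ} (ha : 0 ≤ a) (ha1 : a ≤ 1) (hx : 0 ≤ x) :
    Ψ (a * x) ≤ a * Ψ x := by
  have h := hΨ.convexOn.2 (mem_Ici.2 hx) (mem_Ici.2 le_rfl) ha (sub_nonneg.2 ha1)
    (add_sub_cancel a 1)
  simpa [hΨ.map_zero] using h

/-- Convexity gives continuity only in the interior; at 0 the squeeze 0 ≤ Ψ x ≤ x Ψ 1 is used. -/
lemma IsOrliczFunction.continuousOn : ContinuousOn Ψ (Ici 0) := by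
  intro x hx
  rcases (mem_Ici.1 hx).eq_or_lt with rfl | hx0
  · have hlim : Tendsto (fun x : ℝ => x * Ψ 1) (𝓝[≥] 0) (𝓝 0) := by
      have : Tendsto (fun x : ℝ => x * Ψ 1) (𝓝 0) (𝓝 (0 * Ψ 1)) :=
        (continuous_id.mul continuous_const).tendsto 0
      rw [zero_mul] at this
      exact this.mono_left nhdsWithin_le_nhds
    rw [ContinuousWithinAt, hΨ.map_zero]
    refine tendsto_of_tendsto_of_tendsto_of_le_of_le' tendsto_const_nhds hlim ?_ ?_
    · filter_upwards [self_mem_nhdsWithin] with x hx using hΨ.nonneg hx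
    · filter_upwards [self_mem_nhdsWithin, mem_nhdsWithin_of_mem_nhds (Iic_mem_nhds one_pos)]
        with x hx hx1
      simpa using hΨ.map_mul_le hx hx1 zero_le_one
  · have h := hΨ.convexOn.continuousOn_interior
    rw [interior_Ici] at h
    exact (h.continuousAt (Ioi_mem_nhds hx0)).continuousWithinAt

lemma IsOrliczFunction.exists_le (y : ℝ) : ∃ x, 0 ≤ x ∧ y ≤ Ψ x :=
  ((eventually_ge_atTop 0).and (hΨ.tendsto_atTop.eventually_ge_atTop y)).exists

omit hΨ in
lemma bddBelow_orliczInv_set (Ψ : ℝ → ℝ) (y : ℝ) : BddBelow {x : ℝ | 0 ≤ x ∧ y ≤ Ψ x} :=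
  ⟨0, fun _ hx => hx.1⟩

omit hΨ in
lemma orliczInv_nonneg (Ψ : ℝ → ℝ) (y : ℝ) : 0 ≤ orliczInv Ψ y :=
  Real.sInf_nonneg fun _ hx => hx.1

omit hΨ in
lemma orliczInv_le {x y : ℝ} (hx : 0 ≤ x) (h : y ≤ Ψ x) : orliczInv Ψ y ≤ x :=
  csInf_le (bddBelow_orliczInv_set Ψ y) ⟨hx, h⟩

lemma IsOrliczFunction.map_orliczInv {y : ℝ} (hy : 0 < y) : Ψ (orliczInv Ψ y) = y := by
  obtain ⟨b, hb, hyb⟩ := hΨ.exists_le y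
  obtain ⟨c, hc, rfl⟩ := intermediate_value_Icc hb (hΨ.continuousOn.mono Icc_subset_Ici_self)
    ⟨by rw [hΨ.map_zero]; exact hy.le, hyb⟩
  refine le_antisymm (hΨ.monotoneOn (orliczInv_nonneg _ _) hc.1 (orliczInv_le hc.1 le_rfl)) ?_
  have hcl : IsClosed {x : ℝ | 0 ≤ x ∧ Ψ c ≤ Ψ x} := by
    have := hΨ.continuousOn.preimage_isClosed_of_isClosed isClosed_Ici (isClosed_Ici (a := Ψ c))
    exact this
  exact (hcl.csInf_mem ⟨c, hc.1, le_rfl⟩ (bddBelow_orliczInv_set Ψ _)).2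

/-- Concavity of the inverse, Ψ⁻¹(2y) ≤ 2 Ψ⁻¹(y): if x > 2L with Ψ L = y, then y ≤ (L/x) Ψ x < y. -/
lemma IsOrliczFunction.le_two_mul_orliczInv {x y : ℝ} (hy : 0 < y) (hx : 0 ≤ x)
    (h : Ψ x ≤ 2 * y) : x ≤ 2 * orliczInv Ψ y := by
  by_contra! hlt
  set L := orliczInv Ψ y with hL
  have hL0 : 0 ≤ L := orliczInv_nonneg _ _
  have hΨL : Ψ L = y := hΨ.map_orliczInv hy
  have hxpos : 0 < x := by linarith
  have ha : L / x < 1 / 2 := by rw [div_lt_div_iff₀ hxpos two_pos]; linarith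
  have h1 := hΨ.map_mul_le (a := L / x) (by positivity) (by linarith) hx
  rw [div_mul_cancel₀ _ hxpos.ne', hΨL] at h1
  nlinarith [show 0 ≤ L / x by positivity]

/-- Ψ grows at least linearly, since Ψ x ≥ x/x₀ beyond a point x₀ with Ψ x₀ ≥ 1. This embeds L^Ψ in
L¹ for finite measures. -/
lemma IsOrliczFunction.exists_le_add_mul : ∃ a b : ℝ, ∀ x, 0 ≤ x → x ≤ a + b * Ψ x := by
  obtain ⟨x₀, hx₀, h1⟩ := hΨ.exists_le 1
  refine ⟨x₀, x₀, fun x hx => ?_⟩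
  have hΨx := hΨ.nonneg hx
  rcases le_total x x₀ with h | h
  · nlinarith
  · rcases hx.eq_or_lt with rfl | hxpos
    · nlinarith
    have h2 := hΨ.map_mul_le (a := x₀ / x) (by positivity) ((div_le_one hxpos).2 h) hx
    rw [div_mul_cancel₀ _ hxpos.ne'] at h2
    have h3 : 1 ≤ x₀ * Ψ x / x := by rw [mul_div_right_comm]; linarith
    rw [le_div_iff₀ hxpos] at h3
    linarith

variable {S : Type*} [MeasurableSpace S] {E : Type*} [NormedAddCommGroup E] {μ : Measure S}

lemma IsOrliczFunction.modular_anti (f : S → E) {C D : ℝ} (hC : 0 < C) (h : C ≤ D) :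
    modular Ψ f μ D ≤ modular Ψ f μ C := by
  refine lintegral_mono fun x => ENNReal.ofReal_le_ofReal
    (hΨ.monotoneOn ?_ ?_ (div_le_div_of_nonneg_left (norm_nonneg _) hC h))
  · exact div_nonneg (norm_nonneg _) (hC.le.trans h)
  · exact div_nonneg (norm_nonneg _) hC.le

/-- Enlarging C by the factor T + 1 divides the modular by at least T + 1. Hence the infimum
defining the Luxemburg norm is over a nonempty set and is not the default value 0. -/
lemma IsOrliczFunction.exists_modular_le_one {f : S → E} (hf : MemOrlicz Ψ f μ) :
    ∃ C : ℝ, 0 < C ∧ modular Ψ f μ C ≤ 1 := by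
  obtain ⟨-, C, hC, hfin⟩ := hf
  set T := (modular Ψ f μ C).toReal with hT
  have hT0 : 0 ≤ T := ENNReal.toReal_nonneg
  have hT1 : 0 < T + 1 := by linarith
  refine ⟨C * (T + 1), by positivity, ?_⟩
  have h : modular Ψ f μ (C * (T + 1)) ≤ ENNReal.ofReal (T + 1)⁻¹ * modular Ψ f μ C := by
    rw [modular, modular, ← lintegral_const_mul' _ _ ENNReal.ofReal_ne_top]
    refine lintegral_mono fun x => ?_
    rw [← ENNReal.ofReal_mul (by positivity)]
    refine ENNReal.ofReal_le_ofReal ?_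
    have := hΨ.map_mul_le (a := (T + 1)⁻¹) (x := ‖f x‖ / C) (by positivity)
      (inv_le_one_of_one_le₀ (by linarith)) (by positivity)
    rwa [show (T + 1)⁻¹ * (‖f x‖ / C) = ‖f x‖ / (C * (T + 1)) by field_simp] at this
  refine h.trans ?_
  rw [← ENNReal.ofReal_toReal hfin.ne, ← ENNReal.ofReal_mul (by positivity), ← ENNReal.ofReal_one]
  refine ENNReal.ofReal_le_ofReal ?_
  rw [inv_mul_le_iff₀ hT1]
  linarith

lemma IsOrliczFunction.modular_le_one_of_luxemburgNorm_lt {f : S → E} (hf : MemOrlicz Ψ f μ)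
    {C : ℝ} (h : luxemburgNorm Ψ f μ < C) : modular Ψ f μ C ≤ 1 := by
  obtain ⟨D, ⟨hD, hD1⟩, hDC⟩ := exists_lt_of_csInf_lt (hΨ.exists_modular_le_one hf) h
  exact (hΨ.modular_anti f hD hDC.le).trans hD1

lemma IsOrliczFunction.aestronglyMeasurable_comp {f : S → E} (hf : AEStronglyMeasurable f μ)
    {C : ℝ} (hC : 0 < C) : AEStronglyMeasurable (fun x => Ψ (‖f x‖ / C)) μ := by
  -- Ψ is arbitrary on negative numbers; the maximum with 0 gives a function continuous on the whole
  -- line.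
  have hc : Continuous fun x : ℝ => Ψ (max (x / C) 0) :=
    hΨ.continuousOn.comp_continuous (by fun_prop) fun x => mem_Ici.2 (le_max_right _ 0)
  have h := hc.comp_aestronglyMeasurable hf.norm
  refine h.congr (Eventually.of_forall fun x => ?_)
  simp only
  rw [max_eq_left (by positivity)]

lemma IsOrliczFunction.integrable_comp {f : S → E} (hf : AEStronglyMeasurable f μ) {C : ℝ}
    (hC : 0 < C) (h : modular Ψ f μ C < ⊤) : Integrable (fun x => Ψ (‖f x‖ / C)) μ := by
  refine ⟨hΨ.aestronglyMeasurable_comp hf hC, ?_⟩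
  rw [hasFiniteIntegral_iff_ofReal (Eventually.of_forall fun x => hΨ.nonneg (by positivity))]
  exact h

lemma IsOrliczFunction.integrable_of_memOrlicz [IsFiniteMeasure μ] {f : S → E}
    (hf : MemOrlicz Ψ f μ) : Integrable f μ := by
  obtain ⟨hm, C, hC, hfin⟩ := hf
  obtain ⟨a, b, hab⟩ := hΨ.exists_le_add_mul
  have h := (((integrable_const a).add ((hΨ.integrable_comp hm hC hfin).const_mul b)).const_mul C)
  refine h.mono' hm (Eventually.of_forall fun x => ?_)
  have := hab (‖f x‖ / C) (by positivity)
  rw [div_le_iff₀ hC] at this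
  simp only [Pi.add_apply]
  linarith

end Orlicz

/-! ### Two-sided bounds for point evaluations -/

section PointEvaluation

variable {Ψ : ℝ → ℝ} (hΨ : IsOrliczFunction Ψ)
include hΨ

lemma IsOrliczFunction.norm_le_of_mem_unitBall {f : ℂ → ℂ} (hf : f ∈ unitBall Ψ) {z : ℂ}
    (hz : z ∈ disk) : ‖f z‖ ≤ 2 * orliczInv Ψ (1 / (1 - ‖z‖)) := by
  obtain ⟨N, ⟨hf1, g, hfg, hg, rfl⟩, hN⟩ := hf
  have := isProbabilityMeasure_poissonMeasure hz
  have hz1 : 0 < 1 - ‖z‖ := by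
    have : ‖z‖ < 1 := by simpa using hz
    linarith
  have hgi : Integrable g circleMeasure := hΨ.integrable_of_memOrlicz hg
  have hgμ := integrable_poissonMeasure hz hgi
  -- The modular is known to be at most 1 only for C strictly above the norm, so C tends to 1 at the
  -- end.
  have key : ∀ C : ℝ, 1 < C → ‖f z‖ ≤ 2 * orliczInv Ψ (1 / (1 - ‖z‖)) * C := by
    intro C hC
    have hC0 : 0 < C := one_pos.trans hC
    have hmod := hΨ.modular_le_one_of_luxemburgNorm_lt hg (hN.trans_lt hC)
    have hint := hΨ.integrable_comp hg.1 hC0 (hmod.trans_lt ENNReal.one_lt_top)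
    have hΨ0 : ∀ ζ, 0 ≤ Ψ (‖g ζ‖ / C) := fun ζ => hΨ.nonneg (by positivity)
    have hint1 : ∫ ζ, Ψ (‖g ζ‖ / C) ∂circleMeasure ≤ 1 := by
      rw [← ENNReal.ofReal_le_one,
        ofReal_integral_eq_lintegral_ofReal hint (Eventually.of_forall hΨ0)]
      exact hmod
    have hfz : ‖f z‖ / C ≤ ∫ ζ, ‖g ζ‖ / C ∂poissonMeasure z := by
      rw [integral_div]
      gcongr
      exact norm_le_integral_norm_boundary hf1 hfg hgi hz
    have hjensen := hΨ.convexOn.map_integral_le hΨ.continuousOn isClosed_Ici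
      (Eventually.of_forall fun ζ => mem_Ici.2 (by positivity)) (hgμ.norm.div_const C)
      (integrable_poissonMeasure hz hint)
    have h0 : 0 ≤ ‖f z‖ / C := by positivity
    have h1 : Ψ (‖f z‖ / C) ≤ 2 * (1 / (1 - ‖z‖)) := by
      calc Ψ (‖f z‖ / C) ≤ Ψ (∫ ζ, ‖g ζ‖ / C ∂poissonMeasure z) :=
            hΨ.monotoneOn h0 (h0.trans hfz) hfz
        _ ≤ ∫ ζ, Ψ (‖g ζ‖ / C) ∂poissonMeasure z := hjensen
        _ ≤ 2 / (1 - ‖z‖) * ∫ ζ, Ψ (‖g ζ‖ / C) ∂circleMeasure :=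
            integral_poissonMeasure_le hz hint hΨ0
        _ ≤ 2 / (1 - ‖z‖) * 1 := by gcongr
        _ = 2 * (1 / (1 - ‖z‖)) := by ring
    exact (div_le_iff₀ hC0).1 (hΨ.le_two_mul_orliczInv (by positivity) h0 h1)
  have hlim : Tendsto (fun C : ℝ => 2 * orliczInv Ψ (1 / (1 - ‖z‖)) * C) (𝓝[>] 1)
      (𝓝 (2 * orliczInv Ψ (1 / (1 - ‖z‖)))) := by
    have h := (continuous_const_mul (2 * orliczInv Ψ (1 / (1 - ‖z‖)))).tendsto 1
    rw [mul_one] at h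
    exact h.mono_left nhdsWithin_le_nhds
  refine ge_of_tendsto hlim ?_
  filter_upwards [self_mem_nhdsWithin] with C hC using key C hC

/-- A function in the unit ball of `H^Ψ` which is large at `a`. -/
def peakFunction (Ψ : ℝ → ℝ) (a w : ℂ) : ℂ :=
  orliczInv Ψ (1 / (1 - ‖a‖)) * ((1 - ‖a‖) / (1 - starRingEnd ℂ a * w)) ^ 2

omit hΨ in
lemma one_sub_norm_le {a w : ℂ} (hw : ‖w‖ ≤ 1) : 1 - ‖a‖ ≤ ‖1 - starRingEnd ℂ a * w‖ := by
  have h1 := norm_sub_norm_le (1 : ℂ) (starRingEnd ℂ a * w)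
  rw [norm_one, norm_mul, RCLike.norm_conj] at h1
  nlinarith [norm_nonneg a]

omit hΨ in
lemma norm_peakFunction {a : ℂ} (ha : a ∈ disk) (w : ℂ) :
    ‖peakFunction Ψ a w‖ =
      ((1 - ‖a‖) / ‖1 - starRingEnd ℂ a * w‖) ^ 2 * orliczInv Ψ (1 / (1 - ‖a‖)) := by
  have ha1 : ‖a‖ < 1 := by simpa using ha
  rw [peakFunction, norm_mul, norm_pow, norm_div, Complex.norm_real,
    Real.norm_of_nonneg (orliczInv_nonneg _ _), ← Complex.ofReal_one, ← Complex.ofReal_sub,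
    Complex.norm_real, Real.norm_of_nonneg (by linarith), mul_comm]

omit hΨ in
lemma sq_div_mem_Icc {a w : ℂ} (ha : a ∈ disk) (hw : ‖w‖ ≤ 1) :
    ((1 - ‖a‖) / ‖1 - starRingEnd ℂ a * w‖) ^ 2 ∈ Icc (0 : ℝ) 1 := by
  have ha1 : 0 < 1 - ‖a‖ := by
    have : ‖a‖ < 1 := by simpa using ha
    linarith
  have h := one_sub_norm_le (a := a) hw
  refine ⟨by positivity, pow_le_one₀ (by positivity) ?_⟩
  exact (div_le_one (ha1.trans_le h)).2 h

omit hΨ in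
lemma differentiableOn_peakFunction {a : ℂ} (ha : a ∈ disk) :
    DifferentiableOn ℂ (peakFunction Ψ a) (Metric.closedBall 0 1) := by
  have ha1 : ‖a‖ < 1 := by simpa using ha
  unfold peakFunction
  refine DifferentiableOn.const_mul (DifferentiableOn.pow (DifferentiableOn.div
    (by fun_prop) (by fun_prop) fun w hw h => ?_) 2) _
  have h1 := one_sub_norm_le (a := a) (w := w) (by simpa using hw)
  rw [h, norm_zero] at h1
  linarith

omit hΨ in
/-- On the unit circle the Poisson kernel is a multiple of `1 / |1 - conj a * ζ| ^ 2`. -/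
lemma sq_div_eq_poissonKernel {a ζ : ℂ} (ha : a ∈ disk) (hζ : ζ ∈ Metric.sphere (0 : ℂ) 1) :
    ((1 - ‖a‖) / ‖1 - starRingEnd ℂ a * ζ‖) ^ 2 =
      (1 - ‖a‖) / (1 + ‖a‖) * poissonKernel 0 a ζ := by
  have ha1 : 0 < 1 - ‖a‖ := by
    have : ‖a‖ < 1 := by simpa using ha
    linarith
  have hζ1 : ‖ζ‖ = 1 := by simpa using hζ
  have hnorm : ‖1 - starRingEnd ℂ a * ζ‖ = ‖ζ - a‖ := by
    have h1 : 1 - starRingEnd ℂ a * ζ = ζ * starRingEnd ℂ (ζ - a) := by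
      rw [map_sub, mul_sub, Complex.mul_conj, Complex.normSq_eq_norm_sq, hζ1]
      push_cast; ring
    rw [h1, norm_mul, hζ1, one_mul, RCLike.norm_conj]
  have hpos : 0 < ‖ζ - a‖ := hnorm ▸ ha1.trans_le (one_sub_norm_le hζ1.le)
  rw [hnorm, poissonKernel_def, sub_zero, sub_zero, hζ1]
  have : 0 < 1 + ‖a‖ := by positivity
  field_simp
  ring

/-- With q ≤ 1 the modulus of the squared factor and Ψ L = 1/(1-|a|), convexity gives Ψ(qL) ≤
q/(1-|a|), at most the Poisson kernel at a, whose integral is 1. -/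
lemma IsOrliczFunction.modular_peakFunction_le {a : ℂ} (ha : a ∈ disk) :
    modular Ψ (peakFunction Ψ a) circleMeasure 1 ≤ 1 := by
  have ha1 : 0 < 1 - ‖a‖ := by
    have : ‖a‖ < 1 := by simpa using ha
    linarith
  have hpr := isProbabilityMeasure_poissonMeasure ha
  calc modular Ψ (peakFunction Ψ a) circleMeasure 1
      ≤ ∫⁻ ζ, ENNReal.ofReal (poissonKernel 0 a ζ) ∂circleMeasure := by
        refine lintegral_mono_ae ?_
        filter_upwards [ae_mem_sphere] with ζ hζ
        have hζ1 : ‖ζ‖ ≤ 1 := by simpa using (mem_sphere_zero_iff_norm.1 hζ).le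
        refine ENNReal.ofReal_le_ofReal ?_
        obtain ⟨h0, h1⟩ := sq_div_mem_Icc ha hζ1
        rw [div_one, norm_peakFunction ha]
        refine (hΨ.map_mul_le h0 h1 (orliczInv_nonneg _ _)).trans ?_
        rw [hΨ.map_orliczInv (by positivity), sq_div_eq_poissonKernel ha hζ]
        have hP := poissonKernel_nonneg ha hζ
        have h2 : 1 / (1 + ‖a‖) ≤ 1 := by
          rw [div_le_one (by positivity)]; linarith [norm_nonneg a]
        calc (1 - ‖a‖) / (1 + ‖a‖) * poissonKernel 0 a ζ * (1 / (1 - ‖a‖))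
            = 1 / (1 + ‖a‖) * poissonKernel 0 a ζ := by field_simp
          _ ≤ 1 * poissonKernel 0 a ζ := by gcongr
          _ = poissonKernel 0 a ζ := one_mul _
    _ = poissonMeasure a univ := by
        rw [poissonMeasure, withDensity_apply _ MeasurableSet.univ, Measure.restrict_univ]
    _ = 1 := measure_univ

lemma IsOrliczFunction.peakFunction_mem_unitBall {a : ℂ} (ha : a ∈ disk) :
    peakFunction Ψ a ∈ unitBall Ψ := by
  have hd := differentiableOn_peakFunction (Ψ := Ψ) ha
  have hmod := hΨ.modular_peakFunction_le ha
  refine ⟨_, ⟨⟨hd.mono Metric.ball_subset_closedBall, orliczInv Ψ (1 / (1 - ‖a‖)), ?_⟩,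
    peakFunction Ψ a, ?_, ⟨?_, 1, one_pos, hmod.trans_lt ENNReal.one_lt_top⟩, rfl⟩, ?_⟩
  · intro r hr0 hr1
    have h := norm_integral_le_of_norm_le_const (μ := circleMeasure)
      (f := fun ζ => ‖peakFunction Ψ a ((r : ℂ) * ζ)‖) (C := orliczInv Ψ (1 / (1 - ‖a‖))) ?_
    · rw [probReal_univ, mul_one] at h
      exact (le_abs_self _).trans h
    · filter_upwards [ae_norm_eq_one] with ζ hζ
      have hw : ‖(r : ℂ) * ζ‖ ≤ 1 := by
        rw [norm_mul, hζ, Complex.norm_real, Real.norm_of_nonneg hr0]; linarith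
      obtain ⟨h0, h1⟩ := sq_div_mem_Icc ha hw
      rw [norm_norm, norm_peakFunction ha]
      exact mul_le_of_le_one_left (orliczInv_nonneg _ _) h1
  · unfold HasBoundaryValues
    filter_upwards [ae_norm_eq_one] with ζ hζ
    have h1 : Tendsto (fun r : ℝ => (r : ℂ) * ζ) (𝓝[<] 1) (𝓝[Metric.closedBall 0 1] ζ) := by
      refine tendsto_nhdsWithin_iff.2 ⟨?_, ?_⟩
      · have : Continuous fun r : ℝ => (r : ℂ) * ζ := by fun_prop
        simpa using (this.tendsto 1).mono_left nhdsWithin_le_nhds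
      · filter_upwards [Ioo_mem_nhdsLT (zero_lt_one' ℝ)] with r hr
        rw [mem_closedBall_zero_iff, norm_mul, hζ, Complex.norm_real, Real.norm_of_nonneg hr.1.le]
        linarith [hr.2]
    exact (hd.continuousOn ζ (by simp [hζ])).tendsto.comp h1
  · exact aestronglyMeasurable_circleMeasure
      (hd.continuousOn.mono Metric.sphere_subset_closedBall)
  · exact csInf_le ⟨0, fun _ h => h.1.le⟩ ⟨one_pos, hmod⟩

omit hΨ in
lemma le_norm_peakFunction {a : ℂ} (ha : a ∈ disk) :
    1 / 4 * orliczInv Ψ (1 / (1 - ‖a‖)) ≤ ‖peakFunction Ψ a a‖ := by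
  have ha1 : 0 < 1 - ‖a‖ := by
    have : ‖a‖ < 1 := by simpa using ha
    linarith
  have h0 := norm_nonneg a
  have h1 : ‖1 - starRingEnd ℂ a * a‖ = (1 - ‖a‖) * (1 + ‖a‖) := by
    rw [mul_comm (starRingEnd ℂ a), Complex.mul_conj, Complex.normSq_eq_norm_sq,
      ← Complex.ofReal_one, ← Complex.ofReal_sub, Complex.norm_real, Real.norm_of_nonneg
        (by nlinarith)]
    ring
  rw [norm_peakFunction ha, h1, div_mul_cancel_left₀ ha1.ne']
  refine mul_le_mul_of_nonneg_right ?_ (orliczInv_nonneg _ _)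
  rw [inv_pow, one_div]
  exact inv_anti₀ (by positivity) (by nlinarith)

lemma IsOrliczFunction.two_mul_orliczInv_mem_upperBounds {z : ℂ} (hz : z ∈ disk) :
    2 * orliczInv Ψ (1 / (1 - ‖z‖)) ∈ upperBounds (evalSet Ψ z) := by
  rintro _ ⟨f, hf, rfl⟩
  exact hΨ.norm_le_of_mem_unitBall hf hz

/-- The peak function makes the set nonempty and the upper estimate bounds it, so `sSup` is a
genuine supremum. -/
lemma IsOrliczFunction.isLUB_ballSup {z : ℂ} (hz : z ∈ disk) :
    IsLUB (evalSet Ψ z) (ballSup Ψ z) :=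
  isLUB_csSup ⟨_, mem_image_of_mem _ (hΨ.peakFunction_mem_unitBall hz)⟩
    ⟨_, hΨ.two_mul_orliczInv_mem_upperBounds hz⟩

omit hΨ in
lemma ballSup_nonneg (Ψ : ℝ → ℝ) (z : ℂ) : 0 ≤ ballSup Ψ z := by
  refine Real.sSup_nonneg ?_
  rintro _ ⟨f, -, rfl⟩
  exact norm_nonneg _

lemma IsOrliczFunction.ballSup_le {z : ℂ} (hz : z ∈ disk) :
    ballSup Ψ z ≤ 4 * orliczInv Ψ (1 / (1 - ‖z‖)) := by
  refine ((hΨ.isLUB_ballSup hz).2 (hΨ.two_mul_orliczInv_mem_upperBounds hz)).trans ?_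
  have := orliczInv_nonneg Ψ (1 / (1 - ‖z‖))
  linarith

end PointEvaluation

/-! ### Area estimates and the weak Orlicz bound -/

section WeakOrlicz

lemma diskMeasure_apply (A : Set ℂ) :
    diskMeasure A = ENNReal.ofReal Real.pi⁻¹ * volume (A ∩ disk) := by
  rw [diskMeasure, Measure.smul_apply, Measure.restrict_apply' Metric.isOpen_ball.measurableSet,
    smul_eq_mul]

lemma diskMeasure_le_one (A : Set ℂ) : diskMeasure A ≤ 1 := by
  have hπ := Real.pi_pos
  have h : volume (A ∩ disk) ≤ ENNReal.ofReal Real.pi := by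
    refine (measure_mono inter_subset_right).trans_eq ?_
    rw [Complex.volume_ball, ENNReal.ofReal_one, one_pow, one_mul, ← NNReal.coe_real_pi,
      ENNReal.ofReal_coe_nnreal]
  rw [diskMeasure_apply]
  calc _ ≤ ENNReal.ofReal Real.pi⁻¹ * ENNReal.ofReal Real.pi := by gcongr
    _ = 1 := by
      rw [← ENNReal.ofReal_mul (by positivity), inv_mul_cancel₀ hπ.ne', ENNReal.ofReal_one]

lemma diskMeasure_annulus_le {s : ℝ} (hs0 : 0 ≤ s) (hs1 : s ≤ 1) :
    diskMeasure {z | 1 - s < ‖z‖} ≤ ENNReal.ofReal (2 * s) := by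
  have hπ := Real.pi_pos
  have h : volume ({z : ℂ | 1 - s < ‖z‖} ∩ disk) ≤ ENNReal.ofReal (Real.pi * (2 * s)) := by
    have hsub : {z : ℂ | 1 - s < ‖z‖} ∩ disk ⊆ Metric.ball 0 1 \ Metric.ball 0 (1 - s) := by
      rintro z ⟨hz, hz1⟩
      exact ⟨hz1, fun h => (mem_ball_zero_iff.1 h).not_gt hz⟩
    refine (measure_mono hsub).trans ?_
    rw [measure_sdiff (Metric.ball_subset_ball (by linarith))
      Metric.isOpen_ball.measurableSet.nullMeasurableSet measure_ball_lt_top.ne,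
      Complex.volume_ball, Complex.volume_ball, ← ENNReal.ofReal_coe_nnreal, NNReal.coe_real_pi,
      ← ENNReal.ofReal_pow zero_le_one, ← ENNReal.ofReal_pow (by linarith),
      ← ENNReal.ofReal_mul (by positivity), ← ENNReal.ofReal_mul (by positivity),
      ← ENNReal.ofReal_sub _ (by positivity)]
    exact ENNReal.ofReal_le_ofReal (by nlinarith [mul_nonneg hπ.le (sq_nonneg s)])
  rw [diskMeasure_apply]
  calc _ ≤ ENNReal.ofReal Real.pi⁻¹ * ENNReal.ofReal (Real.pi * (2 * s)) := by gcongr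
    _ = ENNReal.ofReal (2 * s) := by
      rw [← ENNReal.ofReal_mul (by positivity), inv_mul_cancel_left₀ hπ.ne']

variable {Ψ : ℝ → ℝ} (hΨ : IsOrliczFunction Ψ)
include hΨ

/-- The supremum may be over an uncountable family, but its superlevel sets in the disk are unions
of open sets. -/
lemma IsOrliczFunction.aestronglyMeasurable_ballSup :
    AEStronglyMeasurable (ballSup Ψ) diskMeasure := by
  have hmeas : Measurable (indicator disk (ballSup Ψ)) := by
    refine measurable_of_Ioi fun t => ?_
    rcases lt_or_ge t 0 with ht | ht
    · have : indicator disk (ballSup Ψ) ⁻¹' Ioi t = univ :=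
        eq_univ_of_forall fun z =>
          ht.trans_le (indicator_nonneg (fun z _ => ballSup_nonneg Ψ z) z)
      rw [this]; exact MeasurableSet.univ
    · have : indicator disk (ballSup Ψ) ⁻¹' Ioi t =
          ⋃ f ∈ unitBall Ψ, disk ∩ (fun z => ‖f z‖) ⁻¹' Ioi t := by
        ext z
        simp only [mem_preimage, mem_Ioi, mem_iUnion, mem_inter_iff, exists_prop]
        constructor
        · intro h
          by_cases hz : z ∈ disk
          · rw [indicator_of_mem hz] at h
            obtain ⟨_, ⟨f, hf, rfl⟩, hlt⟩ := (lt_isLUB_iff (hΨ.isLUB_ballSup hz)).1 h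
            exact ⟨f, hf, hz, hlt⟩
          · rw [indicator_of_notMem hz] at h
            exact absurd h ht.not_gt
        · rintro ⟨f, hf, hz, hlt⟩
          rw [indicator_of_mem hz]
          exact hlt.trans_le ((hΨ.isLUB_ballSup hz).1 (mem_image_of_mem _ hf))
      rw [this]
      refine (isOpen_biUnion fun f hf => ?_).measurableSet
      obtain ⟨_, ⟨⟨hfd, -⟩, -⟩, -⟩ := hf
      exact hfd.continuousOn.norm.isOpen_inter_preimage Metric.isOpen_ball isOpen_Ioi
  refine hmeas.aestronglyMeasurable.congr ?_
  have h : ∀ᵐ z ∂diskMeasure, z ∈ disk :=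
    Measure.ae_smul_measure (ae_restrict_mem Metric.isOpen_ball.measurableSet) _
  filter_upwards [h] with z hz using indicator_of_mem hz _

lemma IsOrliczFunction.memWeakOrlicz_ballSup : MemWeakOrlicz Ψ (ballSup Ψ) diskMeasure := by
  refine ⟨hΨ.aestronglyMeasurable_ballSup, 1 / 8, by norm_num, fun t ht => ?_⟩
  -- The 4 comes from the bound on `ballSup`. A further halving of the argument, giving c = 1/8,
  -- absorbs the factor 2 in the area of the annulus.
  set v := Ψ (t / 4) with hv
  have hw0 : 0 ≤ Ψ (1 / 8 * t) := hΨ.nonneg (by positivity)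
  have hwv : Ψ (1 / 8 * t) ≤ v / 2 := by
    have h := hΨ.map_mul_le (a := 1 / 2) (x := t / 4) (by norm_num) (by norm_num) (by positivity)
    rw [show 1 / 2 * (t / 4) = 1 / 8 * t by ring] at h
    linarith
  rcases hw0.eq_or_lt with hw | hw
  · rw [← hw, ENNReal.ofReal_zero, ENNReal.inv_zero]
    exact le_top
  rcases le_total v 2 with hv2 | hv2
  -- Here Ψ(t/8) ≤ v/2 ≤ 1, so the right side is at least the total mass 1.
  · refine (diskMeasure_le_one _).trans ?_
    rw [ENNReal.one_le_inv, ENNReal.ofReal_le_one]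
    linarith
  have hv0 : 0 < v := by linarith
  have hsub : {x | t < ‖ballSup Ψ x‖} ∩ disk ⊆ {z | 1 - 1 / v < ‖z‖} := by
    rintro z ⟨hzt, hz⟩
    have hz1 : 0 < 1 - ‖z‖ := by
      have : ‖z‖ < 1 := by simpa using hz
      linarith
    rw [mem_ofPred_eq, Real.norm_of_nonneg (ballSup_nonneg _ _)] at hzt
    have h1 := hΨ.ballSup_le hz
    have h2 : v < 1 / (1 - ‖z‖) := by
      by_contra! hle
      have := orliczInv_le (Ψ := Ψ) (by positivity : 0 ≤ t / 4) hle
      linarith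
    have h3 : 1 - ‖z‖ < 1 / v := (lt_one_div hv0 hz1).1 h2
    simp only [mem_ofPred_eq]
    linarith
  calc diskMeasure {x | t < ‖ballSup Ψ x‖} ≤ diskMeasure {z | 1 - 1 / v < ‖z‖} := by
        rw [diskMeasure_apply, diskMeasure_apply]
        exact mul_le_mul_right (measure_mono (subset_inter hsub inter_subset_right)) _
    _ ≤ ENNReal.ofReal (2 * (1 / v)) :=
        diskMeasure_annulus_le (by positivity) ((div_le_one hv0).2 (by linarith))
    _ ≤ ENNReal.ofReal (Ψ (1 / 8 * t))⁻¹ := by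
        refine ENNReal.ofReal_le_ofReal ?_
        rw [mul_one_div, ← inv_div]
        exact inv_anti₀ hw hwv
    _ = (ENNReal.ofReal (Ψ (1 / 8 * t)))⁻¹ := ENNReal.ofReal_inv_of_pos hw

end WeakOrlicz

end HardyOrlicz

end

theorem mainTheorem9 (Ψ : ℝ → ℝ) (hΨ : HardyOrlicz.IsOrliczFunction Ψ) :
    HardyOrlicz.InjectionOrderBounded Ψ ∧
    (∀ z ∈ HardyOrlicz.disk,
      IsLUB (HardyOrlicz.evalSet Ψ z) (HardyOrlicz.ballSup Ψ z) ∧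
      1 / 4 * HardyOrlicz.orliczInv Ψ (1 / (1 - ‖z‖)) ≤ HardyOrlicz.ballSup Ψ z ∧
      HardyOrlicz.ballSup Ψ z ≤ 4 * HardyOrlicz.orliczInv Ψ (1 / (1 - ‖z‖))) ∧
    HardyOrlicz.MemWeakOrlicz Ψ (HardyOrlicz.ballSup Ψ) HardyOrlicz.diskMeasure := by
  refine ⟨⟨HardyOrlicz.ballSup Ψ, hΨ.memWeakOrlicz_ballSup, HardyOrlicz.ballSup_nonneg Ψ,
    fun f hf => ?_⟩, fun z hz => ⟨hΨ.isLUB_ballSup hz, ?_, hΨ.ballSup_le hz⟩,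
    hΨ.memWeakOrlicz_ballSup⟩
  · have h : ∀ᵐ z ∂HardyOrlicz.diskMeasure, z ∈ HardyOrlicz.disk :=
      Measure.ae_smul_measure (ae_restrict_mem Metric.isOpen_ball.measurableSet) _
    filter_upwards [h] with z hz
    exact (hΨ.isLUB_ballSup hz).1 (mem_image_of_mem _ hf)
  · exact (HardyOrlicz.le_norm_peakFunction hz).trans
      ((hΨ.isLUB_ballSup hz).1 (mem_image_of_mem _ (hΨ.peakFunction_mem_unitBall hz)))
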